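/- There is an absolute constant $C>0$ such that the following holds. Let $\mathcal W$ be a real Hilbert space with inner product $\langle\cdot,\cdot\rangle$ and norm $\|w\|=\sqrt{\langle w,w\rangle}$, let $T\ge 0$ be an integer, and let $\|\cdot\|_1,\dots,\|\cdot\|_{T+1}$ be norms on $\mathcal W$, each induced by an inner product on $\mathcal W$ (for example $\|w\|_t=\sqrt{\langle w,M_tw\rangle}$ with $M_t$ a positive definite self-adjoint operator), such that $\|w\|\le\|w\|_t$ for all $1\le t\le T+1$ and $\|w\|_t\le\|w\|_{t+1}$ for all $1\le t\le T$, for every $w\in\mathcal W$. For $g\in\mathcal W$ let $\|g\|_{t,*}=\sup\{\langle g,h\rangle:\|h\|_t=1\}$. Let $G,\varepsilon>0$, let $\ell_1,\dots,\ell_T:\mathcal W\to\mathbb R$ be convex, let $w_1,\dots,w_T\in\mathcal W$, and let $g_t\in\partial\ell_t(w_t)$ (that is, $\ell_t(v)\ge\ell_t(w_t)+\langle g_t,v-w_t\rangle$ for all $v\in\mathcal W$) with $\|g_t\|_{t,*}\le G$ for $1\le t\le T$. Put $$V_t=4G^2+\sum_{s=1}^{t-1}\|g_s\|_{s,*}^2,\qquad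 \alpha_t=\frac{\varepsilon G}{\sqrt{V_t}\,\log^2(V_t/G^2)},$$ $$\psi_t(w)=3\int_0^{\|w\|_t}\ \inf_{0<\eta\le 1/G}\Big[\frac{\log(x/\alpha_t+1)}{\eta}+\eta V_t\Big]dx,$$ and suppose that the points $w_t$ are the FTRL iterates for these regularizers, i.e. for every $1\le t\le T$ the point $w_t$ minimizes $w\mapsto\big\langle\sum_{s=1}^{t-1}g_s,w\big\rangle+\psi_t(w)$ over $\mathcal W$. Then for every $u\in\mathcal W$ the static regret $R_T(u)=\sum_{t=1}^T(\ell_t(w_t)-\ell_t(u))$ satisfies $$R_T(u)\le C\Big(G\varepsilon+\big(1+\log\log(V_T/G^2)\big)\,\|u\|_{T+1}\max\Big\{\sqrt{V_T\log\Big(\tfrac{\|u\|_{T+1}\sqrt{V_T}}{\varepsilon G}+1\Big)},\ G\log\Big(\tfrac{\|u\|_{T+1}\sqrt{V_T}}{\varepsilon G}+1\Big)\Big\}\Big).$$ -/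

import Mathlib

open scoped InnerProductSpace

noncomputable section

namespace FTRL

variable {W : Type*} [NormedAddCommGroup W] [InnerProductSpace ℝ W]

/-- The norm `‖w‖_P = √⟨w, w⟩_P` of a (further) inner product `P` on `W`. For
`⟨v, w⟩_P = ⟨v, M w⟩` this is the weighted norm `‖w‖_M = √⟨w, M w⟩`. -/
def ipNorm (P : InnerProductSpace.Core ℝ W) (w : W) : ℝ :=
  √(P.inner w w)

/-- The dual norm `sup {⟨g, h⟩ : N h = 1}` of `N`, where `⟨·, ·⟩` is the inner product of the
Hilbert space `W`. -/
def dualNorm (N : W → ℝ) (g : W) : ℝ :=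
  sSup ((fun h : W => ⟪g, h⟫_ℝ) '' {h : W | N h = 1})

/-- `V_t = 4 G² + ∑_{s=1}^{t-1} ‖g_s‖_{s,*}²`. -/
def V (G : ℝ) (N : ℕ → W → ℝ) (g : ℕ → W) (t : ℕ) : ℝ :=
  4 * G ^ 2 + ∑ s ∈ Finset.Ico 1 t, dualNorm (N s) (g s) ^ 2

/-- `α_t = ε G / (√V_t log²(V_t / G²))`, as a function of the value `v` of `V_t`. -/
def alpha (G ε v : ℝ) : ℝ :=
  ε * G / (√v * Real.log (v / G ^ 2) ^ 2)

/-- `min_{η ≤ 1/G} [log(x/α_t + 1)/η + η V_t]` over step sizes `η > 0`, as a function of the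
value `v` of `V_t`. It is an infimum, which at `x = 0` is `0` and is not attained. -/
def slope (G ε v x : ℝ) : ℝ :=
  sInf ((fun η : ℝ => Real.log (x / alpha G ε v + 1) / η + η * v) '' Set.Ioc 0 (1 / G))

/-- The regularizer `ψ_t(w) = 3 ∫_0^{‖w‖_t} min_{η ≤ 1/G} [log(x/α_t + 1)/η + η V_t] dx`. -/
def psi (G ε : ℝ) (N : ℕ → W → ℝ) (g : ℕ → W) (t : ℕ) (w : W) : ℝ :=
  3 * ∫ x in (0 : ℝ)..(N t w), slope G ε (V G N g t) x

/-- The FTRL objective `⟨∑_{s=1}^{t-1} g_s, w⟩ + ψ_t(w)`, which `w_t` minimizes. -/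
def objective (G ε : ℝ) (N : ℕ → W → ℝ) (g : ℕ → W) (t : ℕ) (w : W) : ℝ :=
  ⟪∑ s ∈ Finset.Ico 1 t, g s, w⟫_ℝ + psi G ε N g t w

/-- `g` is a subgradient of `f` at `w`. -/
def IsSubgradientAt (f : W → ℝ) (g w : W) : Prop :=
  ∀ v : W, f w + ⟪g, v - w⟫_ℝ ≤ f v

/-- The static regret `R_T(u) = ∑_{t=1}^T (ℓ_t(w_t) - ℓ_t(u))`. -/
def regret (l : ℕ → W → ℝ) (w : ℕ → W) (T : ℕ) (u : W) : ℝ :=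
  ∑ t ∈ Finset.Icc 1 T, (l t (w t) - l t u)

end FTRL

end

noncomputable section

namespace FTRL

/-! Convexity bounds the regret by the linearized regret, so it suffices to show that the FTRL
objective at time `T + 1`, evaluated at any point, dominates the accumulated `⟪g t, w t⟫` up to `O(G
* ε)`. At `u` this leaves only the regularizer of `u` to estimate. The domination is proved one
round at a time (`ftrl_round`).

By first-order optimality, moving from the iterate `x` to `y` costs a radial Bregman divergence in
the norms `a`, `b` of `x`, `y`, plus an angular term proportional to `b - ⟨x, y⟩ / a`. These must
absorb the loss `γ * ‖y - x‖`. `neg_max_le_sub` reduces the comparison to the purely radial one or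
to a small error. The radial one is `mul_abs_le_bregman`: the integrand grows in `x` at rate at
least `1 / ((x + α) * η)`, so the divergence is of entropy type and a Fenchel-Young inequality
applies.

The errors are of two kinds. A term `γ ^ 2 * b * η`, with `η` the step size at the new point `b`, is
paid by the growth of the potential when `v` becomes `v + γ ^ 2` (`mul_stepSize_le_potential_sub`).
A term `γ ^ 2 * α / √v` is summable because of the squared logarithm in `alpha`
(`sq_mul_alpha_div_sqrt_le`). That squared logarithm reappears inside the logarithm of the final
regularizer, where it costs the `log log` factor (`mul_max_le`). -/

/-- The minimizing step size `min (√(L / v)) (1 / G)` of `η ↦ L / η + η v` over `(0, 1 / G]`. -/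
def stepSize (G v L : ℝ) : ℝ := min (√(L / v)) (1 / G)

/-- The minimal value of `η ↦ L / η + η v` over `(0, 1 / G]`. -/
def slopeVal (G v L : ℝ) : ℝ := max (√(L * v)) (G * L) + v * stepSize G v L

/-! ### Closed form and concavity of the optimal-step-size value. -/

section Slope

variable {G v L : ℝ}

lemma stepSize_nonneg (hG : 0 < G) : 0 ≤ stepSize G v L :=
  le_min (Real.sqrt_nonneg _) (by positivity)

lemma stepSize_pos (hG : 0 < G) (hv : 0 < v) (hL : 0 < L) : 0 < stepSize G v L :=
  lt_min (Real.sqrt_pos.2 (by positivity)) (by positivity)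

lemma stepSize_le_inv : stepSize G v L ≤ 1 / G := min_le_right _ _

lemma stepSize_le_sqrt : stepSize G v L ≤ √(L / v) := min_le_left _ _

lemma slopeVal_zero (hG : 0 < G) : slopeVal G v 0 = 0 := by
  have : (0 : ℝ) ≤ G⁻¹ := by positivity
  simp [slopeVal, stepSize, this]

lemma sqrt_mul_le_slopeVal (hG : 0 < G) (hv : 0 ≤ v) : √(L * v) ≤ slopeVal G v L :=
  (le_max_left _ _).trans (le_add_of_nonneg_right (mul_nonneg hv (stepSize_nonneg hG)))

lemma slopeVal_nonneg (hG : 0 < G) (hv : 0 ≤ v) : 0 ≤ slopeVal G v L :=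
  (Real.sqrt_nonneg _).trans (sqrt_mul_le_slopeVal hG hv)

lemma mul_sqrt_div (hv : 0 < v) : v * √(L / v) = √(L * v) := by
  rw [show L * v = v ^ 2 * (L / v) by field_simp, Real.sqrt_mul (by positivity),
    Real.sqrt_sq hv.le]

lemma slopeVal_le (hv : 0 < v) : slopeVal G v L ≤ 2 * max (√(L * v)) (G * L) := by
  have h1 : v * stepSize G v L ≤ √(L * v) := by
    rw [← mul_sqrt_div hv]
    exact mul_le_mul_of_nonneg_left stepSize_le_sqrt hv.le
  have := le_max_left (√(L * v)) (G * L)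
  unfold slopeVal
  linarith

lemma div_sqrt_div (hv : 0 < v) (hL : 0 < L) : L / √(L / v) = √(L * v) := by
  have : 0 < √(L / v) := Real.sqrt_pos.2 (by positivity)
  rw [div_eq_iff this.ne', ← mul_sqrt_div hv, mul_assoc, Real.mul_self_sqrt (by positivity)]
  field_simp

lemma slopeVal_eq (hG : 0 < G) (hv : 0 < v) (hL : 0 < L) :
    slopeVal G v L = L / stepSize G v L + stepSize G v L * v := by
  have hs : 0 < √(L / v) := Real.sqrt_pos.2 (by positivity)
  have h : max (√(L * v)) (G * L) = L / stepSize G v L := by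
    rw [← div_sqrt_div hv hL, show G * L = L / (1 / G) by field_simp]
    unfold stepSize
    rcases le_total (√(L / v)) (1 / G) with h | h
    · rw [min_eq_left h, max_eq_left (div_le_div_of_nonneg_left hL.le hs h)]
    · rw [min_eq_right h, max_eq_right (div_le_div_of_nonneg_left hL.le (by positivity) h)]
  rw [slopeVal, h, mul_comm v]

lemma slopeVal_le_div_add (hG : 0 < G) (hv : 0 < v) (hL : 0 ≤ L) {η : ℝ} (hη : 0 < η)
    (hηG : η ≤ 1 / G) : slopeVal G v L ≤ L / η + η * v := by
  rcases hL.eq_or_lt with rfl | hL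
  · rw [slopeVal_zero hG]; positivity
  have hs := stepSize_pos hG hv hL
  rw [slopeVal_eq hG hv hL]
  set σ := stepSize G v L with hσ
  -- The difference factors. Both factors have the same sign, except that a capped `σ = 1 / G`
  -- forces `σ = η` when `σ ≤ η`.
  have key : L / η + η * v - (L / σ + σ * v) = (σ - η) * (L - v * η * σ) / (η * σ) := by
    field_simp
    ring
  have h2 : σ ^ 2 ≤ L / v := by
    calc σ ^ 2 ≤ √(L / v) ^ 2 := by gcongr; exact stepSize_le_sqrt
      _ = L / v := Real.sq_sqrt (by positivity)
  rw [le_div_iff₀ hv] at h2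
  have h3 : 0 ≤ (σ - η) * (L - v * η * σ) := by
    rcases le_total η σ with h | h
    · apply mul_nonneg (by linarith)
      have : v * η * σ ≤ v * σ * σ := by gcongr
      nlinarith
    · rcases le_total (√(L / v)) (1 / G) with h' | h'
      · have h4 : σ = √(L / v) := min_eq_left h'
        have h5 : σ ^ 2 * v = L := by
          rw [h4, Real.sq_sqrt (by positivity)]; field_simp
        apply mul_nonneg_of_nonpos_of_nonpos (by linarith)
        have : v * σ * σ ≤ v * η * σ := by gcongr
        nlinarith
      · have h4 : σ = 1 / G := min_eq_right h'
        have : σ = η := le_antisymm h (h4 ▸ hηG)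
        simp [this]
  have : 0 ≤ (σ - η) * (L - v * η * σ) / (η * σ) := by positivity
  linarith

/-- An infimum of functions affine in `(L, v)` is concave, with supergradient `(1 / η, η)` at the
optimal `η`. Concretely, the step size for `(v₂, L₂)` is admissible for `(v₁, L₁)`. -/
lemma slopeVal_add_le (hG : 0 < G) {v₁ v₂ L₁ L₂ : ℝ} (hv₁ : 0 < v₁) (hv₂ : 0 < v₂)
    (hL₁ : 0 ≤ L₁) (hL : L₁ ≤ L₂) :
    slopeVal G v₁ L₁ + (L₂ - L₁) / stepSize G v₂ L₂ + stepSize G v₂ L₂ * (v₂ - v₁) ≤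
      slopeVal G v₂ L₂ := by
  rcases (hL₁.trans hL).eq_or_lt with rfl | hL₂
  · obtain rfl : L₁ = 0 := le_antisymm hL hL₁
    have : (0 : ℝ) ≤ G⁻¹ := by positivity
    simp [slopeVal_zero hG, stepSize, this]
  · have h := slopeVal_le_div_add hG hv₁ hL₁ (stepSize_pos hG hv₂ hL₂) stepSize_le_inv
    rw [slopeVal_eq hG hv₂ hL₂, sub_div]
    linarith

lemma slopeVal_mono (hG : 0 < G) (hv : 0 < v) {L₁ L₂ : ℝ} (hL₁ : 0 ≤ L₁) (hL : L₁ ≤ L₂) :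
    slopeVal G v L₁ ≤ slopeVal G v L₂ := by
  have h := slopeVal_add_le hG hv hv hL₁ hL
  have : 0 ≤ (L₂ - L₁) / stepSize G v L₂ := div_nonneg (by linarith) (stepSize_nonneg hG)
  simp only [sub_self, mul_zero, add_zero] at h
  linarith

lemma stepSize_scale (hG : 0 < G) {v₁ v₂ L₁ L₂ c : ℝ} (hc : 0 ≤ c) (hc1 : c ≤ 1)
    (h : c ^ 2 * (L₁ / v₁) ≤ L₂ / v₂) :
    c * stepSize G v₁ L₁ ≤ stepSize G v₂ L₂ := by
  apply le_min
  · calc c * stepSize G v₁ L₁ ≤ c * √(L₁ / v₁) := by gcongr; exact stepSize_le_sqrt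
      _ = √(c ^ 2 * (L₁ / v₁)) := by rw [Real.sqrt_mul (by positivity), Real.sqrt_sq hc]
      _ ≤ √(L₂ / v₂) := Real.sqrt_le_sqrt h
  · calc c * stepSize G v₁ L₁ ≤ 1 * (1 / G) := by
          gcongr
          · exact stepSize_nonneg hG
          · exact stepSize_le_inv
      _ = 1 / G := one_mul _

lemma stepSize_mono (hv : 0 < v) {L₁ L₂ : ℝ} (h : L₁ ≤ L₂) :
    stepSize G v L₁ ≤ stepSize G v L₂ := by
  unfold stepSize
  gcongr

lemma continuous_slopeVal : Continuous (slopeVal G v) := by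
  unfold slopeVal stepSize
  fun_prop

lemma slope_eq {ε x : ℝ} (hG : 0 < G) (hv : 0 < v) (hα : 0 ≤ alpha G ε v) (hx : 0 ≤ x) :
    slope G ε v x = slopeVal G v (Real.log (x / alpha G ε v + 1)) := by
  have hL : 0 ≤ Real.log (x / alpha G ε v + 1) :=
    Real.log_nonneg (le_add_of_nonneg_left (by positivity))
  unfold slope
  set L := Real.log (x / alpha G ε v + 1) with hLdef
  have hne : (Set.Ioc 0 (1 / G)).Nonempty := ⟨1 / G, by simp [hG]⟩
  rcases hL.eq_or_lt with h0 | hL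
  · rw [← h0, slopeVal_zero hG]
    apply le_antisymm
    · apply le_of_forall_pos_le_add
      intro e he
      -- For `L = 0` the infimum is approached as `η → 0`; this step size has value at most `e`.
      have h1 : (0 : ℝ) < min (1 / G) (e / v) := lt_min (by positivity) (by positivity)
      have hmem := Set.mem_image_of_mem (fun η : ℝ => 0 / η + η * v)
        (show min (1 / G) (e / v) ∈ Set.Ioc 0 (1 / G) from ⟨h1, min_le_left _ _⟩)
      refine (csInf_le ⟨0, ?_⟩ hmem).trans ?_
      · rintro _ ⟨η, hη, rfl⟩
        have := hη.1
        simp only [zero_div, zero_add]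
        positivity
      · have := mul_le_mul_of_nonneg_right (min_le_right (1 / G) (e / v)) hv.le
        rw [div_mul_cancel₀ _ hv.ne'] at this
        simpa using this
    · apply le_csInf (hne.image _)
      rintro _ ⟨η, hη, rfl⟩
      have := hη.1
      simp only [zero_div, zero_add]
      positivity
  · apply IsLeast.csInf_eq
    refine ⟨⟨stepSize G v L, ⟨stepSize_pos hG hv hL, stepSize_le_inv⟩, (slopeVal_eq hG hv hL).symm⟩,
      ?_⟩
    rintro _ ⟨η, hη, rfl⟩
    exact slopeVal_le_div_add hG hv hL.le hη.1 hη.2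

end Slope

/-- The logarithm `log (x / α + 1)` occurring in the regularizer. -/
def logRatio (α x : ℝ) : ℝ := Real.log (x / α + 1)

/-! ### The logarithm in the regularizer. -/

section LogRatio

variable {α x y : ℝ}

lemma logRatio_zero : logRatio α 0 = 0 := by simp [logRatio]

lemma logRatio_nonneg (hα : 0 ≤ α) (hx : 0 ≤ x) : 0 ≤ logRatio α x :=
  Real.log_nonneg (le_add_of_nonneg_left (by positivity))

lemma logRatio_pos (hα : 0 < α) (hx : 0 < x) : 0 < logRatio α x :=
  Real.log_pos (lt_add_of_pos_left _ (by positivity))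

lemma logRatio_mono (hα : 0 ≤ α) (hx : 0 ≤ x) (hxy : x ≤ y) : logRatio α x ≤ logRatio α y := by
  have : 0 ≤ x / α := by positivity
  exact Real.log_le_log (by linarith) (by gcongr)

lemma logRatio_anti {β : ℝ} (hβ : 0 < β) (hβα : β ≤ α) (hx : 0 ≤ x) :
    logRatio α x ≤ logRatio β x := by
  have : 0 ≤ x / α := div_nonneg hx (hβ.le.trans hβα)
  exact Real.log_le_log (by linarith) (by gcongr)

lemma logRatio_eq (hα : 0 < α) (hx : 0 ≤ x) :
    logRatio α x = Real.log (x + α) - Real.log α := by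
  rw [logRatio, ← Real.log_div (by positivity) hα.ne', add_div, div_self hα.ne']

lemma logRatio_le (hα : 0 ≤ α) (hx : 0 ≤ x) : logRatio α x ≤ x / α := by
  have : 0 ≤ x / α := by positivity
  have := Real.log_le_sub_one_of_pos (show 0 < x / α + 1 by linarith)
  unfold logRatio
  linarith

/-- Concavity of `log` on the segment from `1` to `x / α + 1`. -/
lemma mul_logRatio_le {c : ℝ} (hα : 0 ≤ α) (hx : 0 ≤ x) (hc : 0 ≤ c) (hc1 : c ≤ 1) :
    c * logRatio α x ≤ logRatio α (c * x) := by
  have h0 : 0 ≤ x / α := by positivity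
  have h := strictConcaveOn_log_Ioi.concaveOn.2 (show (1 : ℝ) ∈ Set.Ioi 0 by simp)
    (show x / α + 1 ∈ Set.Ioi 0 from add_pos_of_nonneg_of_pos h0 one_pos)
    (show 0 ≤ 1 - c by linarith) hc (by ring)
  simp only [Real.log_one, smul_eq_mul, mul_zero, zero_add] at h
  unfold logRatio
  refine h.trans_eq (congrArg Real.log ?_)
  ring

lemma div_mul_logRatio_le (hα : 0 ≤ α) (hx : 0 ≤ x) (hxy : x ≤ y) (hy : 0 < y) :
    x / y * logRatio α y ≤ logRatio α x := by
  have h := mul_logRatio_le hα hy.le (show 0 ≤ x / y by positivity) ((div_le_one hy).2 hxy)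
  rwa [div_mul_cancel₀ _ hy.ne'] at h

lemma continuousAt_logRatio (hα : 0 < α) (hx : 0 ≤ x) : ContinuousAt (logRatio α) x := by
  have : x / α + 1 ≠ 0 := by positivity
  unfold logRatio
  fun_prop (disch := assumption)

end LogRatio

/-- The one-dimensional regularizer `3 ∫_0^r min_{η ≤ 1/G} [log(x/α + 1)/η + η v] dx`. -/
def potential (G v α r : ℝ) : ℝ := 3 * ∫ x in (0 : ℝ)..r, slopeVal G v (logRatio α x)

/-! ### The radial potential and lower bounds for its Bregman divergence. -/

section Potential

variable {G v α a b γ : ℝ}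

lemma continuousAt_slopeVal_logRatio (hα : 0 < α) {x : ℝ} (hx : 0 ≤ x) :
    ContinuousAt (fun x => slopeVal G v (logRatio α x)) x :=
  continuous_slopeVal.continuousAt.comp (continuousAt_logRatio hα hx)

lemma intervalIntegrable_slopeVal (hα : 0 < α) (ha : 0 ≤ a) (hb : 0 ≤ b) :
    IntervalIntegrable (fun x => slopeVal G v (logRatio α x)) MeasureTheory.volume a b := by
  apply ContinuousOn.intervalIntegrable
  intro x hx
  exact (continuousAt_slopeVal_logRatio hα
    ((le_min ha hb).trans (Set.mem_uIcc.1 hx |>.elim (fun h => (min_le_left _ _).trans h.1)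
      (fun h => (min_le_right _ _).trans h.1)))).continuousWithinAt

lemma potential_zero : potential G v α 0 = 0 := by simp [potential]

lemma potential_sub (hα : 0 < α) (ha : 0 ≤ a) (hb : 0 ≤ b) :
    potential G v α b - potential G v α a =
      3 * ∫ x in a..b, slopeVal G v (logRatio α x) := by
  unfold potential
  rw [← mul_sub, intervalIntegral.integral_interval_sub_left
    (intervalIntegrable_slopeVal hα le_rfl hb) (intervalIntegrable_slopeVal hα le_rfl ha)]

lemma slopeVal_logRatio_mono (hG : 0 < G) (hv : 0 < v) (hα : 0 < α) (ha : 0 ≤ a) (hab : a ≤ b) :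
    slopeVal G v (logRatio α a) ≤ slopeVal G v (logRatio α b) :=
  slopeVal_mono hG hv (logRatio_nonneg hα.le ha) (logRatio_mono hα.le ha hab)

lemma potential_mono (hG : 0 < G) (hv : 0 < v) (hα : 0 < α) (ha : 0 ≤ a) (hab : a ≤ b) :
    potential G v α a ≤ potential G v α b := by
  rw [← sub_nonneg, potential_sub hα ha (ha.trans hab)]
  have := intervalIntegral.integral_nonneg (μ := MeasureTheory.volume) hab
    (fun x _ => slopeVal_nonneg (G := G) (L := logRatio α x) hG hv.le)
  positivity

lemma potential_nonneg (hG : 0 < G) (hv : 0 < v) (hα : 0 < α) (ha : 0 ≤ a) :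
    0 ≤ potential G v α a := by
  simpa [potential_zero] using potential_mono hG hv hα le_rfl ha

lemma potential_le (hG : 0 < G) (hv : 0 < v) (hα : 0 < α) (ha : 0 ≤ a) :
    potential G v α a ≤ 3 * (a * slopeVal G v (logRatio α a)) := by
  unfold potential
  gcongr
  calc ∫ x in (0 : ℝ)..a, slopeVal G v (logRatio α x)
      ≤ ∫ x in (0 : ℝ)..a, slopeVal G v (logRatio α a) :=
        intervalIntegral.integral_mono_on ha (intervalIntegrable_slopeVal hα le_rfl ha)
          intervalIntegrable_const (fun x hx => slopeVal_logRatio_mono hG hv hα hx.1 hx.2)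
    _ = _ := by simp

lemma hasDerivAt_potential (hα : 0 < α) (ha : 0 < a) :
    HasDerivAt (potential G v α) (3 * slopeVal G v (logRatio α a)) a := by
  have hc : ContinuousOn (fun x => slopeVal G v (logRatio α x)) (Set.Ioi 0) := fun x hx =>
    (continuousAt_slopeVal_logRatio hα (le_of_lt hx)).continuousWithinAt
  exact (intervalIntegral.integral_hasDerivAt_right (intervalIntegrable_slopeVal hα le_rfl ha.le)
    (hc.stronglyMeasurableAtFilter isOpen_Ioi a ha)
    (continuousAt_slopeVal_logRatio hα ha.le)).const_mul 3

/-- The Bregman divergence of `potential`. -/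
def bregman (G v α b a : ℝ) : ℝ :=
  potential G v α b - potential G v α a - 3 * slopeVal G v (logRatio α a) * (b - a)

lemma integral_log_add (a b α : ℝ) :
    ∫ x in a..b, Real.log (x + α) =
      (b + α) * Real.log (b + α) - (a + α) * Real.log (a + α) - b + a := by
  rw [intervalIntegral.integral_comp_add_right (fun x => Real.log x), integral_log]
  ring

lemma intervalIntegrable_log_add (hα : 0 < α) (ha : 0 ≤ a) (hb : 0 ≤ b) :
    IntervalIntegrable (fun x => Real.log (x + α)) MeasureTheory.volume a b := by
  apply ContinuousOn.intervalIntegrable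
  intro x hx
  have h0 : 0 ≤ x := ((le_min ha hb).trans (Set.mem_uIcc.1 hx |>.elim
    (fun h => (min_le_left _ _).trans h.1) (fun h => (min_le_right _ _).trans h.1)))
  have : x + α ≠ 0 := by positivity
  apply ContinuousAt.continuousWithinAt
  fun_prop (disch := assumption)

/-- Moving away from the origin: lower bound for the Bregman divergence. -/
lemma le_bregman_of_le (hG : 0 < G) (hv : 0 < v) (hα : 0 < α) (ha : 0 ≤ a) (hab : a < b) :
    3 * (b + α) / stepSize G v (logRatio α b) *
      ((a + α) / (b + α) - 1 - Real.log ((a + α) / (b + α))) ≤ bregman G v α b a := by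
  have hb : 0 < b := ha.trans_lt hab
  have hη := stepSize_pos hG hv (logRatio_pos hα hb)
  set η := stepSize G v (logRatio α b) with hηdef
  set Sa := slopeVal G v (logRatio α a) with hSa
  -- The supergradient inequality at `x` has slope `1 / η(x)`, and `η(x) ≤ η` since step sizes
  -- increase with the logarithm.
  have hpt : ∀ x ∈ Set.Icc a b,
      Sa + (Real.log (x + α) - Real.log (a + α)) / η ≤ slopeVal G v (logRatio α x) := by
    intro x hx
    have hx0 : 0 ≤ x := ha.trans hx.1
    have h := slopeVal_add_le hG hv hv (logRatio_nonneg hα.le ha) (logRatio_mono hα.le ha hx.1)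
    simp only [sub_self, mul_zero, add_zero] at h
    refine le_trans ?_ h
    rw [logRatio_eq hα hx0, logRatio_eq hα ha, sub_sub_sub_cancel_right]
    -- At `x = 0` the step size is zero, so the quotients cannot be compared; there `x = a` and the
    -- bound is an equality.
    rcases hx0.eq_or_lt with h0 | h0
    · have : x = a := le_antisymm (by linarith) hx.1
      subst this
      simp [hSa, logRatio_eq hα hx0]
    rw [← logRatio_eq hα hx0, ← logRatio_eq hα ha]
    gcongr
    · exact sub_nonneg.2 (Real.log_le_log (by linarith) (by linarith [hx.1]))
    · exact stepSize_pos hG hv (logRatio_pos hα h0)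
    · exact stepSize_mono hv (logRatio_mono hα.le hx0 hx.2)
  have hint : IntervalIntegrable (fun x => Sa + (Real.log (x + α) - Real.log (a + α)) / η)
      MeasureTheory.volume a b :=
    intervalIntegrable_const.add
      (((intervalIntegrable_log_add hα ha hb.le).sub intervalIntegrable_const).div_const η)
  have hI := intervalIntegral.integral_mono_on hab.le hint
    (intervalIntegrable_slopeVal hα ha hb.le) hpt
  rw [intervalIntegral.integral_add intervalIntegrable_const
      (((intervalIntegrable_log_add hα ha hb.le).sub intervalIntegrable_const).div_const η),
    intervalIntegral.integral_div, intervalIntegral.integral_sub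
      (intervalIntegrable_log_add hα ha hb.le) intervalIntegrable_const, integral_log_add,
    intervalIntegral.integral_const, intervalIntegral.integral_const] at hI
  simp only [smul_eq_mul] at hI
  rw [bregman, potential_sub hα ha hb.le, Real.log_div (by positivity) (by positivity)]
  have hq : b + α ≠ 0 := by positivity
  have : 3 * (b + α) / η * ((a + α) / (b + α) - 1 - (Real.log (a + α) - Real.log (b + α))) =
      3 * ((b - a) * Sa + ((b + α) * Real.log (b + α) - (a + α) * Real.log (a + α) - b + a -
        (b - a) * Real.log (a + α)) / η) - 3 * Sa * (b - a) := by
    field_simp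
    ring
  rw [this]
  linarith

/-- Moving towards the origin: lower bound for the Bregman divergence. -/
lemma le_bregman_of_ge (hG : 0 < G) (hv : 0 < v) (hα : 0 < α) (hb : 0 ≤ b) (hba : b < a) :
    3 * (b + α) / stepSize G v (logRatio α a) *
      ((a + α) / (b + α) - 1 - Real.log ((a + α) / (b + α))) ≤ bregman G v α b a := by
  have ha : 0 < a := hb.trans_lt hba
  have hη := stepSize_pos hG hv (logRatio_pos hα ha)
  set η := stepSize G v (logRatio α a) with hηdef
  set Sa := slopeVal G v (logRatio α a) with hSa
  -- Here the supergradient is taken at the endpoint `a`, so no comparison of step sizes is needed.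
  have hpt : ∀ x ∈ Set.Icc b a,
      slopeVal G v (logRatio α x) ≤ Sa + (Real.log (x + α) - Real.log (a + α)) / η := by
    intro x hx
    have hx0 : 0 ≤ x := hb.trans hx.1
    have h := slopeVal_add_le hG hv hv (logRatio_nonneg hα.le hx0) (logRatio_mono hα.le hx0 hx.2)
    simp only [sub_self, mul_zero, add_zero] at h
    have h2 : logRatio α a - logRatio α x = -(Real.log (x + α) - Real.log (a + α)) := by
      rw [logRatio_eq hα hx0, logRatio_eq hα ha.le]
      ring
    rw [h2, neg_div, ← hηdef, ← hSa] at h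
    linarith
  have hint : IntervalIntegrable (fun x => Sa + (Real.log (x + α) - Real.log (a + α)) / η)
      MeasureTheory.volume b a :=
    intervalIntegrable_const.add
      (((intervalIntegrable_log_add hα hb ha.le).sub intervalIntegrable_const).div_const η)
  have hI := intervalIntegral.integral_mono_on hba.le
    (intervalIntegrable_slopeVal hα hb ha.le) hint hpt
  rw [intervalIntegral.integral_add intervalIntegrable_const
      (((intervalIntegrable_log_add hα hb ha.le).sub intervalIntegrable_const).div_const η),
    intervalIntegral.integral_div, intervalIntegral.integral_sub
      (intervalIntegrable_log_add hα hb ha.le) intervalIntegrable_const, integral_log_add,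
    intervalIntegral.integral_const, intervalIntegral.integral_const] at hI
  simp only [smul_eq_mul] at hI
  rw [bregman, ← neg_sub (potential G v α a), potential_sub hα hb ha.le,
    Real.log_div (by positivity) (by positivity)]
  have hq : b + α ≠ 0 := by positivity
  have : 3 * (b + α) / η * ((a + α) / (b + α) - 1 - (Real.log (a + α) - Real.log (b + α))) =
      -(3 * ((a - b) * Sa + ((a + α) * Real.log (a + α) - (b + α) * Real.log (b + α) - a + b -
        (a - b) * Real.log (a + α)) / η)) - 3 * Sa * (b - a) := by
    field_simp
    ring
  rw [this]
  linarith

end Potential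

/-! ### Fenchel-Young inequalities for `r - 1 - log r`. -/

/-- Tangent-line bound for `log` at the minimizing point `r = 1 / (1 - e / 3)`; the restriction `e ≤
1` keeps the remainder quadratic. -/
lemma sub_sq_half_le_three_mul {e r : ℝ} (he1 : e ≤ 1) (hr : 0 < r) :
    e * (r - 1) - e ^ 2 / 2 ≤ 3 * (r - 1 - Real.log r) := by
  have hk : 0 < 1 - e / 3 := by linarith
  have h1 := Real.log_le_sub_one_of_pos (mul_pos hr hk)
  rw [Real.log_mul hr.ne' hk.ne'] at h1
  have h2 := Real.one_sub_inv_le_log_of_pos hk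
  have h3 : (1 - e / 3)⁻¹ ≤ 1 + e / 3 + e ^ 2 / 6 := by
    rw [inv_le_iff_one_le_mul₀ hk]
    nlinarith [mul_nonneg (sq_nonneg e) (sub_nonneg.2 he1)]
  nlinarith

lemma sub_sq_third_le_three_mul {e r : ℝ} (he : 0 ≤ e) (hr : 0 < r) :
    e * (1 - r) - e ^ 2 / 3 ≤ 3 * (r - 1 - Real.log r) := by
  have hk : 0 < 1 + e / 3 := by linarith
  have h1 := Real.log_le_sub_one_of_pos (mul_pos hr hk)
  rw [Real.log_mul hr.ne' hk.ne'] at h1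
  have h2 := Real.one_sub_inv_le_log_of_pos hk
  have h3 : (1 + e / 3)⁻¹ ≤ 1 - e / 3 + e ^ 2 / 9 := by
    rw [inv_le_iff_one_le_mul₀ hk]
    nlinarith [pow_nonneg he 3]
  nlinarith

lemma sub_one_le_three_mul {r : ℝ} (hr : 11 / 5 ≤ r) : r - 1 ≤ 3 * (r - 1 - Real.log r) := by
  have h1 := Real.log_le_sub_one_of_pos (show 0 < r / 2 by linarith)
  rw [Real.log_div (by linarith) two_ne_zero] at h1
  have := Real.log_two_lt_d9
  linarith

/-! ### One-dimensional stability and growth of the potential. -/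

section OneDim

variable {G v α a b γ : ℝ}

lemma stepSize_logRatio_le (hv : 0 < v) (hα : 0 < α) {x m : ℝ} (hx : 0 ≤ x) (hm : 0 ≤ m)
    (h : x ≤ m ^ 2 * α) : stepSize G v (logRatio α x) ≤ m / √v := by
  have h1 : logRatio α x ≤ m ^ 2 := (logRatio_le hα.le hx).trans ((div_le_iff₀ hα).2 h)
  calc stepSize G v (logRatio α x) ≤ √(logRatio α x / v) := stepSize_le_sqrt
    _ ≤ √(m ^ 2 / v) := Real.sqrt_le_sqrt (by gcongr)
    _ = m / √v := by rw [Real.sqrt_div (by positivity), Real.sqrt_sq hm]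

/-- With `c = x / y`, concavity gives `c * log(y / α + 1) ≤ log(x / α + 1)`, and `c ^ 2 ≤ c` leaves
room for the square root. -/
lemma div_mul_stepSize_le (hG : 0 < G) (hv : 0 < v) (hα : 0 < α) {x y : ℝ} (hx : 0 ≤ x)
    (hxy : x ≤ y) (hy : 0 < y) :
    x / y * stepSize G v (logRatio α y) ≤ stepSize G v (logRatio α x) := by
  have hc : 0 ≤ x / y := by positivity
  have hc1 : x / y ≤ 1 := (div_le_one hy).2 hxy
  apply stepSize_scale hG hc hc1
  rw [← mul_div_assoc]
  gcongr
  refine le_trans ?_ (div_mul_logRatio_le hα.le hx hxy hy)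
  have := logRatio_nonneg hα.le hy.le
  gcongr
  nlinarith

lemma mul_abs_le_bregman_of_ge (hG : 0 < G) (hv : 0 < v) (hα : 0 < α) (hb : 0 ≤ b)
    (hγ : 0 ≤ γ) (hγG : γ ≤ G) (hba : b < a) :
    γ * (a - b) ≤ bregman G v α b a + 4 / 3 * γ ^ 2 * (b * stepSize G v (logRatio α b)) +
      100 * γ ^ 2 * (α / √v) := by
  have ha : 0 < a := hb.trans_lt hba
  have hB := le_bregman_of_ge hG hv hα hb hba
  have hη := stepSize_pos hG hv (logRatio_pos hα ha)
  have hηb := stepSize_nonneg (v := v) (L := logRatio α b) hG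
  have hle : stepSize G v (logRatio α a) ≤ 1 / G := stepSize_le_inv
  have hscale := div_mul_stepSize_le hG hv hα hb hba.le ha
  have hsmall := fun h => stepSize_logRatio_le (G := G) (m := 7) hv hα ha.le (by norm_num) h
  set η := stepSize G v (logRatio α a)
  set ηb := stepSize G v (logRatio α b)
  have he1 : γ * η ≤ 1 := by
    calc γ * η ≤ G * (1 / G) := by gcongr
      _ = 1 := by field_simp
  have hq : 0 < b + α := by positivity
  set q := b + α with hqdef
  set r := (a + α) / q with hr
  have hr0 : 0 < r := by positivity
  have hqr : q * (r - 1) = a - b := by rw [hr]; field_simp; rw [hqdef]; ring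
  have hrest : 0 ≤ 4 / 3 * γ ^ 2 * (b * ηb) + 100 * γ ^ 2 * (α / √v) := by positivity
  rw [show 3 * q / η * (r - 1 - Real.log r) = q / η * (3 * (r - 1 - Real.log r)) by ring] at hB
  have hqη : 0 ≤ q / η := by positivity
  -- For large `r` the divergence beats the linear loss outright, because `γ * η ≤ 1`. Otherwise `a`
  -- is comparable to `b + α`, so the step size at `a` can be traded for the one at `b`.
  rcases le_or_gt (11 / 5) r with h | h
  · have h1 := mul_le_mul_of_nonneg_left (sub_one_le_three_mul h) hqη
    have h2 : γ * (a - b) ≤ q / η * (r - 1) := by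
      rw [← hqr, show γ * (q * (r - 1)) = q / η * ((γ * η) * (r - 1)) by field_simp]
      gcongr
      nlinarith
    linarith
  · have h1 := mul_le_mul_of_nonneg_left
      (sub_sq_half_le_three_mul he1 hr0) hqη
    have h2 : q / η * (γ * η * (r - 1) - (γ * η) ^ 2 / 2) =
        γ * (a - b) - γ ^ 2 * (η * q / 2) := by
      rw [← hqr]; field_simp
    have h3 : η * q / 2 ≤ 4 / 3 * (b * ηb) + 100 * (α / √v) := by
      have h4 : a + α ≤ 11 / 5 * q := by
        rw [hr, div_lt_iff₀ hq] at h; exact h.le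
      have hαv : 0 ≤ α / √v := by positivity
      -- If `20 * α ≤ b`, then `a ≤ 113 / 50 * b`. If not, `a ≤ 49 * α`, whence the value `m = 7` in
      -- `hsmall`.
      rcases le_or_gt (20 * α) b with h5 | h5
      · have h6 : b * η ≤ a * ηb := by
          rw [div_mul_eq_mul_div, div_le_iff₀ ha] at hscale
          linarith
        have hb0 : 0 < b := by linarith
        have h7 : b * η ≤ 113 / 50 * b * ηb := by
          refine h6.trans ?_
          gcongr
          linarith
        have h8 : q ≤ 21 / 20 * b := by linarith
        nlinarith
      · have h6 := hsmall (by linarith)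
        have h7 : η * q ≤ 7 / √v * (21 * α) := by gcongr; linarith
        have h8 : 7 / √v * (21 * α) = 147 * (α / √v) := by ring
        have : 0 ≤ b * ηb := by positivity
        linarith
    have h4 := mul_le_mul_of_nonneg_left h3 (sq_nonneg γ)
    linarith

lemma mul_abs_le_bregman_of_le (hG : 0 < G) (hv : 0 < v) (hα : 0 < α) (ha : 0 ≤ a)
    (hγ : 0 ≤ γ) (hab : a < b) :
    γ * (b - a) ≤ bregman G v α b a + 4 / 3 * γ ^ 2 * (b * stepSize G v (logRatio α b)) +
      100 * γ ^ 2 * (α / √v) := by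
  have hb : 0 < b := ha.trans_lt hab
  have hB := le_bregman_of_le hG hv hα ha hab
  have hη := stepSize_pos hG hv (logRatio_pos hα hb)
  have hsmall := fun h => stepSize_logRatio_le (G := G) (m := 5) hv hα hb.le (by norm_num) h
  set η := stepSize G v (logRatio α b)
  have hq : 0 < b + α := by positivity
  set q := b + α with hqdef
  set r := (a + α) / q with hr
  have hr0 : 0 < r := by positivity
  have hqr : q * (1 - r) = b - a := by rw [hr]; field_simp; rw [hqdef]; ring
  rw [show 3 * q / η * (r - 1 - Real.log r) = q / η * (3 * (r - 1 - Real.log r)) by ring] at hB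
  have h1 := mul_le_mul_of_nonneg_left
    (sub_sq_third_le_three_mul (e := γ * η) (by positivity) hr0) (show 0 ≤ q / η by positivity)
  have h2 : q / η * (γ * η * (1 - r) - (γ * η) ^ 2 / 3) =
      γ * (b - a) - γ ^ 2 * (η * q / 3) := by
    rw [← hqr]; field_simp
  have h3 : η * q / 3 ≤ 4 / 3 * (b * η) + 100 * (α / √v) := by
    have hαv : 0 ≤ α / √v := by positivity
    have hbη : 0 ≤ b * η := by positivity
    rcases le_or_gt (20 * α) b with h5 | h5
    · have h8 : η * q ≤ η * (21 / 20 * b) := by gcongr; linarith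
      linarith
    · have h6 := hsmall (by linarith)
      have h7 : η * q ≤ 5 / √v * (21 * α) := by gcongr; linarith
      have h8 : 5 / √v * (21 * α) = 105 * (α / √v) := by ring
      linarith
  have h4 := mul_le_mul_of_nonneg_left h3 (sq_nonneg γ)
  linarith

lemma mul_abs_le_bregman (hG : 0 < G) (hv : 0 < v) (hα : 0 < α) (ha : 0 ≤ a) (hb : 0 ≤ b)
    (hγ : 0 ≤ γ) (hγG : γ ≤ G) :
    γ * |b - a| ≤ bregman G v α b a + 4 / 3 * γ ^ 2 * (b * stepSize G v (logRatio α b)) +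
      100 * γ ^ 2 * (α / √v) := by
  rcases lt_trichotomy a b with h | rfl | h
  · rw [abs_of_pos (by linarith)]
    exact mul_abs_le_bregman_of_le hG hv hα ha hγ h
  · have := stepSize_nonneg (v := v) (L := logRatio α a) hG
    simp only [bregman, sub_self, abs_zero, mul_zero]
    positivity
  · rw [abs_of_neg (by linarith), neg_sub]
    exact mul_abs_le_bregman_of_ge hG hv hα hb hγ hγG h

lemma bregman_nonneg (hG : 0 < G) (hv : 0 < v) (hα : 0 < α) (ha : 0 ≤ a) (hb : 0 ≤ b) :
    0 ≤ bregman G v α b a := by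
  simpa using mul_abs_le_bregman hG hv hα ha hb le_rfl hG.le

/-- Bounds the angular error in the case where `b` is close to `a`. For `a` of order `α` the slope
is at least of order `a * √v / α`. For larger `a` the slope exceeds `1 / η` and `2 * G`, so `b` is
within `a / 6` of `a` and the step sizes at `a` and `b` are comparable. -/
lemma sq_mul_div_slopeVal_le (hG : 0 < G) (hv : 4 * G ^ 2 ≤ v) (hα : 0 < α) (ha : 0 < a) (hb : 0 ≤ b)
    (hγG : γ ≤ G)
    (hab : |b - a| * (3 * slopeVal G v (logRatio α a)) ≤ a * γ) :
    γ ^ 2 * (a / (3 * slopeVal G v (logRatio α a))) ≤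
      4 / 3 * γ ^ 2 * (b * stepSize G v (logRatio α b)) + 100 * γ ^ 2 * (α / √v) := by
  have hv0 : 0 < v := lt_of_lt_of_le (by positivity) hv
  have hsv : 0 < √v := Real.sqrt_pos.2 hv0
  have hG2 : 2 * G ≤ √v := Real.le_sqrt_of_sq_le (by linarith)
  have hL := logRatio_pos hα ha
  have hS1 := sqrt_mul_le_slopeVal (L := logRatio α a) hG hv0.le
  have hη := stepSize_pos hG hv0 hL
  have hSeq := slopeVal_eq hG hv0 hL
  have hηb := stepSize_nonneg (v := v) (L := logRatio α b) hG
  have hS0 : 0 < slopeVal G v (logRatio α a) := by rw [hSeq]; positivity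
  set S := slopeVal G v (logRatio α a)
  set η := stepSize G v (logRatio α a) with hηdef
  rw [Real.sqrt_mul hL.le] at hS1
  suffices h : a / (3 * S) ≤ 4 / 3 * (b * stepSize G v (logRatio α b)) + 100 * (α / √v) by
    have := mul_le_mul_of_nonneg_left h (sq_nonneg γ)
    linarith
  have hd : |b - a| ≤ a * (γ / (3 * S)) := by
    rw [← mul_div_assoc, le_div_iff₀ (by positivity)]; exact hab
  rcases le_or_gt a (40 * α) with h | h
  · have h1 : a / α / 41 ≤ logRatio α a := by
      have hz : 0 ≤ a / α := by positivity
      have hz' : a / α ≤ 40 := (div_le_iff₀ hα).2 h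
      have := Real.one_sub_inv_le_log_of_pos (show 0 < a / α + 1 by positivity)
      refine le_trans ?_ this
      rw [show 1 - (a / α + 1)⁻¹ = a / α / (a / α + 1) by field_simp; ring]
      gcongr
      linarith
    have h2 : a / α / 41 ≤ √(logRatio α a) := by
      apply Real.le_sqrt_of_sq_le
      have hz : 0 ≤ a / α / 41 := by positivity
      have hz' : a / α / 41 ≤ 1 := by
        rw [div_le_one (by norm_num), div_le_iff₀ hα]; linarith
      nlinarith
    have h3 : a / α / 41 * √v ≤ S := (mul_le_mul_of_nonneg_right h2 hsv.le).trans hS1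
    have h4 : a / (3 * S) ≤ a / (3 * (a / α / 41 * √v)) := by gcongr
    have h5 : a / (3 * (a / α / 41 * √v)) = 41 / 3 * (α / √v) := by field_simp
    have hαv : 0 ≤ α / √v := by positivity
    have : 0 ≤ b * stepSize G v (logRatio α b) := by positivity
    linarith
  · have hL1 : 1 ≤ logRatio α a := by
      rw [logRatio, Real.le_log_iff_exp_le (by positivity)]
      have := Real.exp_one_lt_d9
      have : 40 < a / α := (lt_div_iff₀ hα).2 h
      linarith
    have hS2 : 1 / η ≤ S := by
      have : 1 / η ≤ logRatio α a / η := by gcongr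
      have : 0 ≤ η * v := by positivity
      linarith
    have hS3 : 2 * G ≤ S := by
      have : 1 ≤ √(logRatio α a) := by rw [Real.one_le_sqrt]; exact hL1
      nlinarith
    have h6 : γ / (3 * S) ≤ 1 / 6 := by
      rw [div_le_iff₀ (by positivity)]; linarith
    have hd' : |b - a| ≤ a * (1 / 6) := hd.trans (by gcongr)
    have hba := (abs_le.1 hd').1
    have hb : 0 < b := by linarith
    have h7 : 5 / 6 * η ≤ stepSize G v (logRatio α b) := by
      rcases le_total a b with hab | hab
      · have := stepSize_mono (G := G) hv0 (logRatio_mono hα.le ha.le hab)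
        linarith
      · refine le_trans ?_ (div_mul_stepSize_le hG hv0 hα hb.le hab ha)
        rw [← hηdef]
        refine mul_le_mul_of_nonneg_right ?_ hη.le
        rw [le_div_iff₀ ha]
        linarith
    have h8 : a / (3 * S) ≤ a / (3 * (1 / η)) := by gcongr
    have h9 : a / (3 * (1 / η)) = a * η / 3 := by field_simp
    have h10 : (5 / 6 * a) * (5 / 6 * η) ≤ b * stepSize G v (logRatio α b) := by
      gcongr
      linarith
    have hαv : 0 ≤ α / √v := by positivity
    have : 0 ≤ a * η := by positivity
    linarith

/-- Raising `v` by `γ ^ 2` raises the integrand at `x` by at least `γ ^ 2` times the new step size,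
which is at least `8 / 9 * (x / b)` times the old one at `b`. Integrating this linear bound gives `3
* 4 / 9 = 4 / 3`. -/
lemma mul_stepSize_le_potential_sub (hG : 0 < G) (hv : 4 * G ^ 2 ≤ v) {α' : ℝ} (hα' : 0 < α')
    (hαα' : α' ≤ α) (hγ : 0 ≤ γ) (hγG : γ ≤ G) (hb : 0 ≤ b) :
    4 / 3 * γ ^ 2 * (b * stepSize G v (logRatio α b)) ≤
      potential G (v + γ ^ 2) α' b - potential G v α b := by
  have hα : 0 < α := hα'.trans_le hαα'
  have hv0 : 0 < v := lt_of_lt_of_le (by positivity) hv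
  have hv' : 0 < v + γ ^ 2 := by positivity
  have hvv : v + γ ^ 2 ≤ 5 / 4 * v := by nlinarith
  rcases hb.eq_or_lt with rfl | hb
  · simp [potential_zero]
  set η := stepSize G v (logRatio α b)
  have hpt : ∀ x ∈ Set.Icc 0 b, slopeVal G v (logRatio α x) + (8 / 9 * γ ^ 2 * η / b) * x ≤
      slopeVal G (v + γ ^ 2) (logRatio α' x) := by
    intro x hx
    have hLL := logRatio_anti hα' hαα' hx.1
    have hLx := logRatio_nonneg hα.le hx.1
    have h := slopeVal_add_le hG hv0 hv' hLx hLL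
    have h0 : 0 ≤ (logRatio α' x - logRatio α x) /
        stepSize G (v + γ ^ 2) (logRatio α' x) :=
      div_nonneg (sub_nonneg.2 hLL) (stepSize_nonneg hG)
    have hxb : 0 ≤ x / b := div_nonneg hx.1 hb.le
    have hxb1 : x / b ≤ 1 := (div_le_one hb).2 hx.2
    have h1 : 8 / 9 * (x / b) * η ≤ stepSize G (v + γ ^ 2) (logRatio α' x) := by
      apply stepSize_scale hG (by positivity) (by linarith)
      have hLb := logRatio_nonneg hα.le hb.le
      have h2 := div_mul_logRatio_le hα.le hx.1 hx.2 hb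
      rw [← mul_div_assoc, div_le_div_iff₀ hv0 hv']
      have h3 : (x / b) ^ 2 * logRatio α b ≤ logRatio α' x := by
        refine le_trans ?_ (h2.trans hLL)
        gcongr
        nlinarith
      have h4 : 0 ≤ (x / b) ^ 2 * logRatio α b := by positivity
      -- The factor `8 / 9` is chosen so that `(8 / 9) ^ 2 * (5 / 4) = 80 / 81 ≤ 1`.
      calc (8 / 9 * (x / b)) ^ 2 * logRatio α b * (v + γ ^ 2)
          ≤ (8 / 9 * (x / b)) ^ 2 * logRatio α b * (5 / 4 * v) := by gcongr
        _ = 80 / 81 * ((x / b) ^ 2 * logRatio α b * v) := by ring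
        _ ≤ 1 * ((x / b) ^ 2 * logRatio α b * v) := by
          gcongr
          norm_num
        _ ≤ logRatio α' x * v := by rw [one_mul]; gcongr
    have h5 := mul_le_mul_of_nonneg_right h1 (sq_nonneg γ)
    rw [add_sub_cancel_left] at h
    have : 8 / 9 * γ ^ 2 * η / b * x = 8 / 9 * (x / b) * η * γ ^ 2 := by ring
    linarith
  have hlin : IntervalIntegrable (fun x => (8 / 9 * γ ^ 2 * η / b) * x) MeasureTheory.volume 0 b :=
    (continuous_const.mul continuous_id).intervalIntegrable _ _
  have hI := intervalIntegral.integral_mono_on hb.le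
    ((intervalIntegrable_slopeVal hα le_rfl hb.le).add hlin)
    (intervalIntegrable_slopeVal hα' le_rfl hb.le) hpt
  rw [intervalIntegral.integral_add (intervalIntegrable_slopeVal hα le_rfl hb.le) hlin,
    intervalIntegral.integral_const_mul, integral_id] at hI
  unfold potential
  have : 8 / 9 * γ ^ 2 * η / b * ((b ^ 2 - 0 ^ 2) / 2) = 4 / 9 * γ ^ 2 * (b * η) := by
    field_simp
    ring
  linarith

end OneDim

/-! ### Optimality conditions and one FTRL round in an inner-product norm. -/

section InnerProduct

variable {W : Type*} [NormedAddCommGroup W] [InnerProductSpace ℝ W]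

lemma core_inner_comm (P : InnerProductSpace.Core ℝ W) (x y : W) :
    P.inner x y = P.inner y x := by
  simpa using P.conj_inner_symm y x

lemma core_inner_self_nonneg (P : InnerProductSpace.Core ℝ W) (x : W) : 0 ≤ P.inner x x := by
  simpa using P.re_inner_nonneg x

lemma core_inner_add_smul_self (P : InnerProductSpace.Core ℝ W) (x y : W) (c : ℝ) :
    P.inner (x + c • y) (x + c • y) =
      P.inner x x + 2 * c * P.inner x y + c ^ 2 * P.inner y y := by
  have hl : ∀ z, P.inner (x + c • y) z = P.inner x z + c * P.inner y z := fun z => by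
    have := P.smul_left y z c
    simp only [conj_trivial] at this
    rw [P.add_left, this]
  rw [hl, core_inner_comm P x, core_inner_comm P y, hl, hl, core_inner_comm P y x]
  ring

lemma ipNorm_nonneg (P : InnerProductSpace.Core ℝ W) (x : W) : 0 ≤ ipNorm P x :=
  Real.sqrt_nonneg _

lemma ipNorm_sq (P : InnerProductSpace.Core ℝ W) (x : W) : ipNorm P x ^ 2 = P.inner x x :=
  Real.sq_sqrt (core_inner_self_nonneg P x)

lemma ipNorm_smul (P : InnerProductSpace.Core ℝ W) (x : W) (c : ℝ) :
    ipNorm P (c • x) = |c| * ipNorm P x := by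
  have h := core_inner_add_smul_self P 0 x c
  have h0 : ∀ z, P.inner 0 z = 0 := fun z => by
    have := P.add_left 0 0 z
    simpa using this
  simp only [zero_add, h0, mul_zero] at h
  unfold ipNorm
  rw [h, Real.sqrt_mul (sq_nonneg c), Real.sqrt_sq_eq_abs]

lemma eq_zero_of_ipNorm_eq_zero (P : InnerProductSpace.Core ℝ W) {x : W} (h : ipNorm P x = 0) :
    x = 0 := by
  apply P.definite
  rw [← ipNorm_sq, h]
  ring

lemma core_inner_le (P : InnerProductSpace.Core ℝ W) (x y : W) :
    P.inner x y ≤ ipNorm P x * ipNorm P y := by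
  have h := discrim_le_zero (a := P.inner y y) (b := 2 * P.inner x y) (c := P.inner x x)
    (fun c => by
      have := core_inner_self_nonneg P (x + c • y)
      rw [core_inner_add_smul_self] at this
      linarith)
  rw [discrim] at h
  apply le_of_sq_le_sq _ (mul_nonneg (ipNorm_nonneg P x) (ipNorm_nonneg P y))
  rw [mul_pow, ipNorm_sq, ipNorm_sq]
  linarith

variable {G v α : ℝ}

/-- First-order optimality of an FTRL iterate away from the origin. -/
lemma inner_eq_of_isMinOn (P : InnerProductSpace.Core ℝ W) (hα : 0 < α) {θ x : W}
    (hmin : IsMinOn (fun y => ⟪θ, y⟫_ℝ + potential G v α (ipNorm P y)) Set.univ x)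
    (hx : 0 < ipNorm P x) (h : W) :
    ⟪θ, h⟫_ℝ = -(3 * slopeVal G v (logRatio α (ipNorm P x)) * (P.inner x h / ipNorm P x)) := by
  set φ : ℝ → ℝ := fun τ => ⟪θ, x + τ • h⟫_ℝ + potential G v α (ipNorm P (x + τ • h)) with hφ
  have hmin' : IsLocalMin φ 0 := by
    apply Filter.Eventually.of_forall
    intro τ
    simpa [hφ] using hmin (Set.mem_univ (x + τ • h))
  have hn : HasDerivAt (fun τ : ℝ => ipNorm P (x + τ • h)) (P.inner x h / ipNorm P x) 0 := by
    have h1 : HasDerivAt (fun τ : ℝ => P.inner x x + 2 * τ * P.inner x h + τ ^ 2 * P.inner h h)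
        (2 * P.inner x h) 0 := by
      have := ((((hasDerivAt_id (0 : ℝ)).const_mul 2).mul_const (P.inner x h)).const_add
        (P.inner x x)).add (((hasDerivAt_id (0 : ℝ)).pow 2).mul_const (P.inner h h))
      exact HasDerivAt.congr_deriv this (by simp)
    have h2 := h1.sqrt (by
      have : 0 < P.inner x x := by rw [← ipNorm_sq]; positivity
      simpa using this.ne')
    simp only [mul_zero, zero_mul, add_zero, ne_eq, OfNat.ofNat_ne_zero, not_false_eq_true,
      zero_pow] at h2
    unfold ipNorm
    simp only [core_inner_add_smul_self]
    convert h2 using 1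
    rw [mul_div_mul_left _ _ two_ne_zero]
  have hd : HasDerivAt φ (⟪θ, h⟫_ℝ +
      3 * slopeVal G v (logRatio α (ipNorm P x)) * (P.inner x h / ipNorm P x)) 0 := by
    have h1 : HasDerivAt (fun τ : ℝ => ⟪θ, x + τ • h⟫_ℝ) ⟪θ, h⟫_ℝ 0 := by
      simp only [inner_add_right, inner_smul_right]
      simpa using ((hasDerivAt_id (0 : ℝ)).mul_const ⟪θ, h⟫_ℝ).const_add ⟪θ, x⟫_ℝ
    refine h1.add (HasDerivAt.comp (0 : ℝ) (h₂ := potential G v α) ?_ hn)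
    simpa using hasDerivAt_potential hα hx
  have := hmin'.hasDerivAt_eq_zero hd
  linarith

/-- First-order optimality of an FTRL iterate at the origin. -/
lemma inner_eq_zero_of_isMinOn (P : InnerProductSpace.Core ℝ W) (hG : 0 < G) (hv : 0 < v)
    (hα : 0 < α) {θ : W}
    (hmin : IsMinOn (fun y => ⟪θ, y⟫_ℝ + potential G v α (ipNorm P y)) Set.univ 0) (h : W) :
    ⟪θ, h⟫_ℝ = 0 := by
  have hn0 : ipNorm P (0 : W) = 0 := by simpa using ipNorm_smul P (0 : W) 0
  have key : ∀ h, 0 ≤ ⟪θ, h⟫_ℝ := by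
    intro h
    set c := ipNorm P h
    have hc : 0 ≤ c := ipNorm_nonneg P h
    have hev : ∀ τ : ℝ, 0 < τ →
        0 ≤ ⟪θ, h⟫_ℝ + 3 * (c * slopeVal G v (logRatio α (τ * c))) := by
      intro τ hτ
      have h1 := hmin (Set.mem_univ (τ • h))
      simp only [Set.mem_ofPred_eq, inner_zero_right, hn0, potential_zero, add_zero,
        inner_smul_right, ipNorm_smul, abs_of_pos hτ] at h1
      have h2 := potential_le hG hv hα (show 0 ≤ τ * c by positivity)
      have h3 : 0 ≤ τ * (⟪θ, h⟫_ℝ + 3 * (c * slopeVal G v (logRatio α (τ * c)))) := by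
        change 0 ≤ τ * ⟪θ, h⟫_ℝ + potential G v α (τ * c) at h1
        linarith
      exact nonneg_of_mul_nonneg_right h3 hτ
    -- The slope vanishes at the origin, so the regularizer contributes nothing to first order.
    have hlim : Filter.Tendsto
        (fun τ : ℝ => ⟪θ, h⟫_ℝ + 3 * (c * slopeVal G v (logRatio α (τ * c))))
        (nhdsWithin 0 (Set.Ioi 0)) (nhds ⟪θ, h⟫_ℝ) := by
      have h1 : ContinuousAt (fun τ : ℝ => slopeVal G v (logRatio α (τ * c))) 0 :=
        ContinuousAt.comp (f := fun τ : ℝ => τ * c) (x := (0 : ℝ))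
          (continuousAt_slopeVal_logRatio hα (by simp)) (by fun_prop)
      have h2 : ContinuousAt
          (fun τ : ℝ => ⟪θ, h⟫_ℝ + 3 * (c * slopeVal G v (logRatio α (τ * c)))) 0 := by
        fun_prop
      have h3 := h2.tendsto
      simp only [zero_mul, logRatio_zero, slopeVal_zero hG, mul_zero, add_zero] at h3
      exact h3.mono_left nhdsWithin_le_nhds
    exact ge_of_tendsto hlim (Filter.eventually_of_mem self_mem_nhdsWithin hev)
  have h1 := key (-h)
  rw [inner_neg_right] at h1
  exact le_antisymm (by linarith) (key h)

/-- Minimizes `p * y - γ * r` along `r ^ 2 = d ^ 2 + 2 * a * y`, a quadratic in `r ≥ d` with vertex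
`a * γ / p`. Either the vertex lies below `d` and the worst case is radial (`y = 0`), or the value
at the vertex is bounded using `d * p ≤ a * γ`. -/
lemma neg_max_le_sub {p γ a d y r : ℝ} (ha : 0 < a) (hp : 0 < p) (hγ : 0 ≤ γ) (hd : 0 ≤ d)
    (hr : 0 ≤ r) (hy : 0 ≤ y) (h : r ^ 2 = d ^ 2 + 2 * a * y) :
    (-(γ * d) ≤ p * y - γ * r) ∨ (d * p ≤ a * γ ∧ -(γ ^ 2 * (a / p)) ≤ p * y - γ * r) := by
  have hy' : y = (r ^ 2 - d ^ 2) / (2 * a) := by rw [h]; field_simp; ring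
  have hrd : d ≤ r := by
    apply le_of_sq_le_sq _ hr
    rw [h]
    have : 0 ≤ 2 * a * y := by positivity
    linarith
  rcases le_total (a * γ) (d * p) with h1 | h1
  · left
    have h2 : γ * (r - d) ≤ p * y := by
      rw [hy', ← mul_div_assoc, le_div_iff₀ (by positivity)]
      have h3 : 0 ≤ r - d := by linarith
      have h4 : a * γ * (2 * (r - d)) ≤ d * p * (2 * (r - d)) := by gcongr
      nlinarith [mul_nonneg hp.le (mul_nonneg h3 h3)]
    linarith
  · refine Or.inr ⟨h1, ?_⟩
    have h2 : p * y - γ * r + γ ^ 2 * (a / p) =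
        ((p * r - a * γ) ^ 2 + ((a * γ) ^ 2 - (d * p) ^ 2)) / (2 * a * p) := by
      rw [hy']; field_simp; ring
    have h3 : (d * p) ^ 2 ≤ (a * γ) ^ 2 := by gcongr
    have h4 : 0 ≤ ((p * r - a * γ) ^ 2 + ((a * γ) ^ 2 - (d * p) ^ 2)) / (2 * a * p) := by
      have := sub_nonneg.2 h3
      positivity
    linarith

/-- One round of FTRL: the value of the next objective dominates the value of the current one plus
the linearized loss, up to a summable error. -/
lemma ftrl_round (P : InnerProductSpace.Core ℝ W) (hG : 0 < G) (hv : 4 * G ^ 2 ≤ v) {α' γ : ℝ}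
    (hα' : 0 < α') (hαα' : α' ≤ α) (hγ : 0 ≤ γ) (hγG : γ ≤ G) {θ g x : W}
    (hg : ∀ h, |⟪g, h⟫_ℝ| ≤ γ * ipNorm P h)
    (hmin : IsMinOn (fun y => ⟪θ, y⟫_ℝ + potential G v α (ipNorm P y)) Set.univ x) (y : W) :
    ⟪θ, x⟫_ℝ + potential G v α (ipNorm P x) + ⟪g, x⟫_ℝ - 100 * γ ^ 2 * (α / √v) ≤
      ⟪θ + g, y⟫_ℝ + potential G (v + γ ^ 2) α' (ipNorm P y) := by
  have hα : 0 < α := hα'.trans_le hαα'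
  have hv0 : 0 < v := lt_of_lt_of_le (by positivity) hv
  have ha := ipNorm_nonneg P x
  have hb := ipNorm_nonneg P y
  have hcomp := mul_stepSize_le_potential_sub (b := ipNorm P y) hG hv hα' hαα' hγ hγG hb
  have hmove := mul_abs_le_bregman hG hv0 hα ha hb hγ hγG
  have hgyx := (abs_le.1 (hg (y - x))).1
  rw [inner_sub_right] at hgyx
  rw [inner_add_left]
  rcases ha.eq_or_lt with ha0 | ha
  · obtain rfl := eq_zero_of_ipNorm_eq_zero P ha0.symm
    rw [inner_eq_zero_of_isMinOn P hG hv0 hα hmin y]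
    simp only [← ha0, bregman, potential_zero, logRatio_zero, slopeVal_zero hG, sub_zero,
      inner_zero_right, abs_of_nonneg hb] at *
    linarith
  · set a := ipNorm P x
    set b := ipNorm P y
    have hθ := inner_eq_of_isMinOn P hα hmin ha
    have hS : 0 < 3 * slopeVal G v (logRatio α a) := by
      have := logRatio_pos hα ha
      have : 0 < √(logRatio α a * v) := Real.sqrt_pos.2 (by positivity)
      have := this.trans_le (sqrt_mul_le_slopeVal hG hv0.le)
      positivity
    have hcs := core_inner_le P x y
    have hxx : P.inner x x / a = a := by rw [← ipNorm_sq, sq, mul_div_assoc, div_self ha.ne', mul_one]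
    -- The squared distance splits into a radial part and the angular deficit `b - ⟨x, y⟩ / a`,
    -- which is nonnegative by Cauchy-Schwarz.
    have hr : ipNorm P (y - x) ^ 2 = |b - a| ^ 2 + 2 * a * (b - P.inner x y / a) := by
      have h1 := core_inner_add_smul_self P y x (-1)
      rw [neg_one_smul, ← sub_eq_add_neg, ← ipNorm_sq, ← ipNorm_sq, ← ipNorm_sq,
        core_inner_comm P y x] at h1
      rw [h1, sq_abs, mul_sub, mul_assoc 2 a (_ / a), mul_div_cancel₀ _ ha.ne']
      ring
    have hy0 : 0 ≤ b - P.inner x y / a := by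
      rw [sub_nonneg, div_le_iff₀ ha]
      linarith
    have hx' := hθ x
    have hy' := hθ y
    rw [hxx] at hx'
    rw [hx', hy']
    unfold bregman at hmove
    have hB := bregman_nonneg hG hv0 hα ha.le hb
    unfold bregman at hB
    rcases neg_max_le_sub ha hS hγ (abs_nonneg (b - a)) (ipNorm_nonneg P (y - x)) hy0 hr with
      h | ⟨h1, h2⟩
    · linarith
    · have := sq_mul_div_slopeVal_le hG hv hα ha hb hγG h1
      linarith

end InnerProduct

/-! ### Summability of the errors and the cost of the squared logarithm. -/

section Scalar

lemma one_le_log_of_four_le {a : ℝ} (ha : 4 ≤ a) : 1 ≤ Real.log a := by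
  rw [Real.le_log_iff_exp_le (by linarith)]
  have := Real.exp_one_lt_d9
  linarith

lemma log_le_five_fourths_mul {a b : ℝ} (ha : 4 ≤ a) (hb : 0 < b) (hba : b ≤ 5 / 4 * a) :
    Real.log b ≤ 5 / 4 * Real.log a := by
  have h1 := Real.log_le_sub_one_of_pos (show 0 < b / a by positivity)
  rw [Real.log_div hb.ne' (by linarith)] at h1
  have h2 : b / a ≤ 5 / 4 := (div_le_iff₀ (by linarith)).2 hba
  have := one_le_log_of_four_le ha
  linarith

/-- Discrete form of `∫ dx / (x log² x) = -1 / log x`. The ratio bound `b ≤ 5 / 4 * a` costs a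
factor `(5 / 4) ^ 2 ≤ 2`. -/
lemma div_mul_log_sq_le {a b : ℝ} (ha : 4 ≤ a) (hab : a ≤ b) (hba : b ≤ 5 / 4 * a) :
    (b - a) / (a * Real.log a ^ 2) ≤ 2 * (1 / Real.log a - 1 / Real.log b) := by
  have ha0 : 0 < a := by linarith
  have hb0 : 0 < b := by linarith
  have hla := one_le_log_of_four_le ha
  have hlb := one_le_log_of_four_le (ha.trans hab)
  have hlb' := log_le_five_fourths_mul ha hb0 hba
  have h1 := Real.one_sub_inv_le_log_of_pos (show 0 < b / a by positivity)
  rw [Real.log_div hb0.ne' ha0.ne', inv_div] at h1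
  have h2 : 4 / 5 * ((b - a) / a) ≤ 1 - a / b := by
    rw [show 1 - a / b = (b - a) / b by field_simp, ← mul_div_assoc, div_le_div_iff₀ ha0 hb0]
    nlinarith
  set x := Real.log a
  set y := Real.log b
  have h3 : 0 ≤ (b - a) / a := div_nonneg (by linarith) ha0.le
  rw [show (b - a) / (a * x ^ 2) = (b - a) / a / x ^ 2 by field_simp,
    show 2 * (1 / x - 1 / y) = 2 * (y - x) / (x * y) by field_simp,
    div_le_div_iff₀ (by positivity) (by positivity)]
  calc (b - a) / a * (x * y) ≤ (b - a) / a * (x * (5 / 4 * x)) := by gcongr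
    _ = 5 / 4 * ((b - a) / a) * x ^ 2 := by ring
    _ ≤ 2 * (y - x) * x ^ 2 := mul_le_mul_of_nonneg_right (by linarith) (sq_nonneg x)

lemma half_le_sqrt_mul_sqrt_log {μ z : ℝ} (hμ : 1 ≤ μ) (hz : 0 ≤ z) (hz1 : z ≤ 1)
    (h : 1 ≤ √μ * z) : 1 / 2 ≤ √μ * √(Real.log (z + 1)) := by
  have h3 : z / 2 ≤ Real.log (z + 1) := by
    refine le_trans ?_ (Real.one_sub_inv_le_log_of_pos (show 0 < z + 1 by positivity))
    rw [show 1 - (z + 1)⁻¹ = z / (z + 1) by field_simp; ring]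
    gcongr
    linarith
  have hsμ : 1 ≤ √μ := Real.one_le_sqrt.2 hμ
  rw [← Real.sqrt_mul (by positivity)]
  apply Real.le_sqrt_of_sq_le
  have h5 : √μ * (√μ * z) = μ * z := by
    rw [← mul_assoc, Real.mul_self_sqrt (by positivity)]
  have h6 : 1 * 1 ≤ √μ * (√μ * z) := by gcongr
  have h7 : μ * (z / 2) ≤ μ * Real.log (z + 1) := by gcongr
  linarith

set_option maxHeartbeats 1000000 in
/-- Comparison of `U * max (√(L V')) (G L)`, where `L = log (U / α' + 1)`, with the quantity in the
regret bound, in which the logarithm lacks the factor `log² (V' / G²)`. -/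
lemma mul_max_le {G ε v v' U : ℝ} (hG : 0 < G) (hε : 0 < ε) (hv : 4 * G ^ 2 ≤ v) (hvv : v ≤ v')
    (hvv' : v' ≤ 5 / 4 * v) (hU : 0 ≤ U) :
    U * max (√(logRatio (alpha G ε v') U * v')) (G * logRatio (alpha G ε v') U) ≤
      4 * (G * ε + (1 + Real.log (Real.log (v / G ^ 2))) *
        (U * max (√(v * Real.log (U * √v / (ε * G) + 1)))
          (G * Real.log (U * √v / (ε * G) + 1)))) := by
  have hG2 : 0 < G ^ 2 := by positivity
  have hv0 : 0 < v := by linarith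
  have hv0' : 0 < v' := by linarith
  have hr4 : 4 ≤ v / G ^ 2 := by rwa [le_div_iff₀ hG2]
  have hlam := one_le_log_of_four_le hr4
  have hr4' : v / G ^ 2 ≤ v' / G ^ 2 := by gcongr
  have hlam' := one_le_log_of_four_le (hr4.trans hr4')
  have hlamle := log_le_five_fourths_mul hr4 (show 0 < v' / G ^ 2 by positivity)
    (by rw [← mul_div_assoc]; gcongr)
  have hsv : 0 < √v := Real.sqrt_pos.2 hv0
  have hsv' : √v' ≤ 9 / 8 * √v := by
    rw [Real.sqrt_le_left (by positivity), mul_pow, Real.sq_sqrt hv0.le]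
    linarith
  have hlogle : Real.log (v / G ^ 2) ≤ 2 * (√v / G) := by
    have h1 := Real.log_le_sub_one_of_pos (show 0 < √v / G by positivity)
    have h2 : v / G ^ 2 = (√v / G) ^ 2 := by rw [div_pow, Real.sq_sqrt hv0.le]
    rw [h2, Real.log_pow]
    push_cast
    linarith
  set lam := Real.log (v / G ^ 2)
  set lam' := Real.log (v' / G ^ 2) with hlamdef
  have hloglam := Real.log_nonneg hlam
  have hloglam2 := Real.log_le_sub_one_of_pos (show 0 < lam by linarith)
  obtain ⟨μ, hμ⟩ : ∃ μ, μ = 1 + Real.log lam := ⟨_, rfl⟩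
  rw [← hμ]
  have hμ1 : 1 ≤ μ := by linarith
  obtain ⟨z, hz⟩ : ∃ z, z = U * √v / (ε * G) := ⟨_, rfl⟩
  rw [← hz]
  have hz0 : 0 ≤ z := by rw [hz]; positivity
  have hUz : U * √v = z * (ε * G) := by rw [hz]; field_simp
  have hL : logRatio (alpha G ε v') U ≤ Real.log (2 * z * lam ^ 2 + 1) := by
    have h1 : U / alpha G ε v' = U * √v' / (ε * G) * lam' ^ 2 := by
      rw [alpha, ← hlamdef, div_div_eq_mul_div]
      ring
    have h2 : U / alpha G ε v' ≤ 2 * z * lam ^ 2 := by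
      rw [h1]
      calc U * √v' / (ε * G) * lam' ^ 2
          ≤ U * (9 / 8 * √v) / (ε * G) * (5 / 4 * lam) ^ 2 := by gcongr
        _ = 225 / 128 * (z * lam ^ 2) := by rw [hz]; ring
        _ ≤ 2 * z * lam ^ 2 := by
          have : 0 ≤ z * lam ^ 2 := by positivity
          linarith
    have h3 : 0 ≤ U / alpha G ε v' := by rw [h1]; positivity
    exact Real.log_le_log (by linarith) (by linarith)
  have hL0 : 0 ≤ logRatio (alpha G ε v') U := by
    apply logRatio_nonneg _ hU
    unfold alpha
    positivity
  set L := logRatio (alpha G ε v') U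
  set l := Real.log (z + 1) with hl
  have hl0 : 0 ≤ l := Real.log_nonneg (by linarith)
  set M := max (√(v * l)) (G * l) with hM
  have hM1 : √(v * l) ≤ M := le_max_left _ _
  have hM2 : G * l ≤ M := le_max_right _ _
  have hM0 : 0 ≤ M := (Real.sqrt_nonneg _).trans hM1
  have hGε : 0 < G * ε := by positivity
  have hμUM : 0 ≤ μ * (U * M) := by positivity
  -- For `z ≥ 1` the extra `2 * log lam` is absorbed multiplicatively, as `log (z + 1)` is bounded
  -- below. For `z < 1` the point is so small that `U * √v ≤ G * ε`.
  rcases le_or_gt 1 z with h | h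
  · have hll : 69 / 100 ≤ l := by
      have h1 := Real.log_two_gt_d9
      have h2 : Real.log 2 ≤ l := Real.log_le_log two_pos (by linarith)
      linarith
    have hLl : L ≤ 3 * μ * l := by
      have h1 : Real.log (2 * z * lam ^ 2 + 1) ≤ Real.log ((z + 1) * (2 * lam ^ 2)) :=
        Real.log_le_log (by positivity) (by nlinarith)
      rw [Real.log_mul (by positivity) (by positivity), Real.log_mul (by norm_num) (by positivity),
        Real.log_pow] at h1
      push_cast at h1
      have h2 : Real.log 2 ≤ l := Real.log_le_log two_pos (by linarith)
      have h3 : Real.log lam = μ - 1 := by linarith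
      nlinarith
    have hmax : max (√(L * v')) (G * L) ≤ 3 * μ * M := by
      apply max_le
      · calc √(L * v') ≤ √((3 * μ) ^ 2 * (v * l)) := by
              apply Real.sqrt_le_sqrt
              calc L * v' ≤ 3 * μ * l * (5 / 4 * v) := by gcongr
                _ = 15 / 4 * μ * (v * l) := by ring
                _ ≤ (3 * μ) ^ 2 * (v * l) := by
                  gcongr
                  nlinarith
          _ = 3 * μ * √(v * l) := by
              rw [Real.sqrt_mul (by positivity), Real.sqrt_sq (by positivity)]
          _ ≤ 3 * μ * M := by gcongr
      · calc G * L ≤ G * (3 * μ * l) := by gcongr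
          _ = 3 * μ * (G * l) := by ring
          _ ≤ 3 * μ * M := by gcongr
    calc U * max (√(L * v')) (G * L) ≤ U * (3 * μ * M) := by gcongr
      _ = 3 * (μ * (U * M)) := by ring
      _ ≤ _ := by linarith
  · have hLμ : L ≤ 2 * μ := by
      have h1 : Real.log (2 * z * lam ^ 2 + 1) ≤ Real.log (3 * lam ^ 2) :=
        Real.log_le_log (by positivity) (by nlinarith)
      rw [Real.log_mul (by norm_num) (by positivity), Real.log_pow] at h1
      push_cast at h1
      have h2 := Real.log_le_sub_one_of_pos (show (0 : ℝ) < 3 by norm_num)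
      linarith
    rw [mul_max_of_nonneg _ _ hU]
    apply max_le
    · have h1 : U * √(L * v') ≤ 2 * (√μ * (U * √v)) := by
        have : √(L * v') ≤ √(2 ^ 2 * (μ * v)) := by
          apply Real.sqrt_le_sqrt
          calc L * v' ≤ 2 * μ * (5 / 4 * v) := by gcongr
            _ ≤ 2 ^ 2 * (μ * v) := by
              have : 0 ≤ μ * v := by positivity
              linarith
        rw [Real.sqrt_mul (sq_nonneg (2 : ℝ)), Real.sqrt_sq (zero_le_two (α := ℝ)),
          Real.sqrt_mul (show 0 ≤ μ by linarith)] at this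
        calc U * √(L * v') ≤ U * (2 * (√μ * √v)) := by gcongr
          _ = _ := by ring
      -- Either the term is itself of order `G * ε`, or `√μ * √l` is bounded below and can be
      -- inserted as a factor.
      rcases le_or_gt (√μ * z) 1 with h2 | h2
      · have h3 : √μ * (U * √v) ≤ G * ε := by
          rw [hUz]
          nlinarith
        linarith
      · have h4 : 1 / 2 ≤ √μ * √l := half_le_sqrt_mul_sqrt_log hμ1 hz0 h.le h2.le
        have h5 : √μ * (U * √v) ≤ 2 * (μ * (U * M)) := by
          calc √μ * (U * √v) = 2 * (√μ * (U * √v) * (1 / 2)) := by ring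
            _ ≤ 2 * (√μ * (U * √v) * (√μ * √l)) := by gcongr
            _ = 2 * (√μ * √μ * (U * (√v * √l))) := by ring
            _ ≤ 2 * (μ * (U * M)) := by
              rw [Real.mul_self_sqrt (by positivity), ← Real.sqrt_mul hv0.le]
              gcongr
        linarith
    -- Here `μ ≤ lam ≤ 2 * √v / G` removes the iterated logarithm entirely.
    · have h1 : G * L ≤ 4 * √v := by
        have : L ≤ 4 * (√v / G) := by linarith
        calc G * L ≤ G * (4 * (√v / G)) := by gcongr
          _ = 4 * √v := by field_simp
      have h2 : U * (G * L) ≤ 4 * (U * √v) := by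
        calc U * (G * L) ≤ U * (4 * √v) := by gcongr
          _ = _ := by ring
      rw [hUz] at h2
      nlinarith

lemma alpha_pos {G ε v : ℝ} (hG : 0 < G) (hε : 0 < ε) (hv : 4 * G ^ 2 ≤ v) :
    0 < alpha G ε v := by
  have hG2 : 0 < G ^ 2 := by positivity
  have := one_le_log_of_four_le ((le_div_iff₀ hG2).2 hv)
  have hv0 : 0 < v := by linarith
  unfold alpha
  positivity

lemma alpha_anti {G ε v v' : ℝ} (hG : 0 < G) (hε : 0 < ε) (hv : 4 * G ^ 2 ≤ v) (hvv : v ≤ v') :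
    alpha G ε v' ≤ alpha G ε v := by
  have hG2 : 0 < G ^ 2 := by positivity
  have := one_le_log_of_four_le ((le_div_iff₀ hG2).2 hv)
  have hv0 : 0 < v := by linarith
  have hr : 0 < v / G ^ 2 := by positivity
  unfold alpha
  gcongr

lemma sq_mul_alpha_div_sqrt_le {G ε v γ : ℝ} (hG : 0 < G) (hε : 0 < ε) (hv : 4 * G ^ 2 ≤ v)
    (hγ : 0 ≤ γ) (hγG : γ ≤ G) :
    γ ^ 2 * (alpha G ε v / √v) ≤
      2 * (G * ε) * (1 / Real.log (v / G ^ 2) - 1 / Real.log ((v + γ ^ 2) / G ^ 2)) := by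
  have hG2 : 0 < G ^ 2 := by positivity
  have hv0 : 0 < v := by linarith
  have hr4 : 4 ≤ v / G ^ 2 := by rwa [le_div_iff₀ hG2]
  have hlam := one_le_log_of_four_le hr4
  have h := div_mul_log_sq_le hr4 (b := (v + γ ^ 2) / G ^ 2)
    (by gcongr; nlinarith) (by rw [← mul_div_assoc]; gcongr; nlinarith)
  have h1 : γ ^ 2 * (alpha G ε v / √v) = G * ε * (((v + γ ^ 2) / G ^ 2 - v / G ^ 2) /
      (v / G ^ 2 * Real.log (v / G ^ 2) ^ 2)) := by
    have hs : √v ≠ 0 := (Real.sqrt_pos.2 hv0).ne'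
    have hss : √v * √v = v := Real.mul_self_sqrt hv0.le
    set lam := Real.log (v / G ^ 2) with hlamdef
    rw [alpha, ← hlamdef, div_div, mul_right_comm, hss]
    field_simp
    ring
  rw [h1]
  calc _ ≤ G * ε * _ := mul_le_mul_of_nonneg_left h (by positivity)
    _ = _ := by ring

end Scalar

/-! ### Dual norms and the induction over rounds. -/

section Regret

variable {W : Type*} [NormedAddCommGroup W] [InnerProductSpace ℝ W]

lemma dualNorm_nonneg {N : W → ℝ} {P : InnerProductSpace.Core ℝ W} (hN : N = ipNorm P)
    (hle : ∀ v, ‖v‖ ≤ N v) (g : W) : 0 ≤ dualNorm N g := by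
  -- In the trivial space there are no unit vectors, and the supremum of the empty set is `0`.
  rcases Set.eq_empty_or_nonempty {h : W | N h = 1} with h | ⟨h, hh⟩
  · simp [dualNorm, h]
  have hbdd : BddAbove ((fun h : W => ⟪g, h⟫_ℝ) '' {h : W | N h = 1}) := by
    refine ⟨‖g‖, ?_⟩
    rintro _ ⟨h, hh, rfl⟩
    have h1 : ‖h‖ ≤ 1 := (hle h).trans_eq hh
    calc ⟪g, h⟫_ℝ ≤ ‖g‖ * ‖h‖ := real_inner_le_norm g h
      _ ≤ ‖g‖ * 1 := by gcongr
      _ = ‖g‖ := mul_one _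
  have hneg : N (-h) = 1 := by
    have := ipNorm_smul P h (-1)
    rw [hN] at hh ⊢
    simpa [show ipNorm P h = 1 from hh] using this
  have h1 : ⟪g, h⟫_ℝ ≤ dualNorm N g := le_csSup hbdd ⟨h, hh, rfl⟩
  have h2 : ⟪g, -h⟫_ℝ ≤ dualNorm N g := le_csSup hbdd ⟨-h, hneg, rfl⟩
  rw [inner_neg_right] at h2
  linarith

lemma abs_inner_le_dualNorm_mul {N : W → ℝ} {P : InnerProductSpace.Core ℝ W} (hN : N = ipNorm P)
    (hle : ∀ v, ‖v‖ ≤ N v) (g h : W) : |⟪g, h⟫_ℝ| ≤ dualNorm N g * N h := by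
  have hbdd : BddAbove ((fun h : W => ⟪g, h⟫_ℝ) '' {h : W | N h = 1}) := by
    refine ⟨‖g‖, ?_⟩
    rintro _ ⟨h, hh, rfl⟩
    have h1 : ‖h‖ ≤ 1 := (hle h).trans_eq hh
    calc ⟪g, h⟫_ℝ ≤ ‖g‖ * ‖h‖ := real_inner_le_norm g h
      _ ≤ ‖g‖ * 1 := by gcongr
      _ = ‖g‖ := mul_one _
  have key : ∀ h, ⟪g, h⟫_ℝ ≤ dualNorm N g * N h := by
    intro h
    have hn : 0 ≤ N h := (norm_nonneg h).trans (hle h)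
    rcases hn.eq_or_lt with h0 | hpos
    · have : h = 0 := eq_zero_of_ipNorm_eq_zero P (by rw [← hN]; exact h0.symm)
      rw [this, inner_zero_right, ← this, ← h0, mul_zero]
    · have h1 : N ((N h)⁻¹ • h) = 1 := by
        conv_lhs => rw [hN, ipNorm_smul, ← hN, abs_of_pos (inv_pos.2 hpos)]
        exact inv_mul_cancel₀ hpos.ne'
      have h2 : ⟪g, (N h)⁻¹ • h⟫_ℝ ≤ dualNorm N g := le_csSup hbdd ⟨_, h1, rfl⟩
      rw [inner_smul_right, inv_mul_le_iff₀ hpos] at h2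
      linarith
  rw [abs_le]
  refine ⟨?_, key h⟩
  have h1 := key (-h)
  have h2 : N (-h) = N h := by
    have := ipNorm_smul P h (-1)
    rw [hN]
    simpa using this
  rw [inner_neg_right, h2] at h1
  linarith

variable {G ε : ℝ} {N : ℕ → W → ℝ} {g : ℕ → W}

lemma four_mul_sq_le_V (t : ℕ) : 4 * G ^ 2 ≤ V G N g t :=
  le_add_of_nonneg_right (Finset.sum_nonneg fun _ _ => sq_nonneg _)

lemma V_succ {t : ℕ} (ht : 1 ≤ t) : V G N g (t + 1) = V G N g t + dualNorm (N t) (g t) ^ 2 := by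
  rw [V, V, Finset.sum_Ico_succ_top ht]
  ring

lemma psi_eq (hG : 0 < G) (hε : 0 < ε) {t : ℕ} {y : W} (hy : 0 ≤ N t y) :
    psi G ε N g t y = potential G (V G N g t) (alpha G ε (V G N g t)) (N t y) := by
  have hv := four_mul_sq_le_V (G := G) (N := N) (g := g) t
  unfold psi potential
  congr 1
  apply intervalIntegral.integral_congr
  intro x hx
  rw [Set.uIcc_of_le hy] at hx
  exact slope_eq hG (lt_of_lt_of_le (by positivity) hv) (alpha_pos hG hε hv).le hx.1

/-- Quantifying over all `y` lets the induction hypothesis be used at the next iterate. The error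
telescopes from `V 1 = 4 * G ^ 2`, hence `1 / log 4`. -/
lemma sum_inner_le_objective (T : ℕ) (P : ℕ → InnerProductSpace.Core ℝ W)
    (hN : ∀ t, N t = ipNorm (P t)) (hle : ∀ t ∈ Finset.Icc 1 (T + 1), ∀ v : W, ‖v‖ ≤ N t v)
    (hmono : ∀ t ∈ Finset.Icc 1 T, ∀ v : W, N t v ≤ N (t + 1) v) {w : ℕ → W}
    (hG : 0 < G) (hε : 0 < ε) (hg : ∀ t ∈ Finset.Icc 1 T, dualNorm (N t) (g t) ≤ G)
    (hw : ∀ t ∈ Finset.Icc 1 T, IsMinOn (objective G ε N g t) Set.univ (w t)) :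
    ∀ k ≤ T, ∀ y : W,
      ∑ t ∈ Finset.Ico 1 (k + 1), ⟪g t, w t⟫_ℝ -
          200 * (G * ε) * (1 / Real.log 4 - 1 / Real.log (V G N g (k + 1) / G ^ 2)) ≤
        objective G ε N g (k + 1) y := by
  have hN0 : ∀ t y, 0 ≤ N t y := fun t y => by rw [hN]; exact ipNorm_nonneg _ _
  intro k
  induction k with
  | zero =>
    intro _ y
    have hv := four_mul_sq_le_V (G := G) (N := N) (g := g) 1
    have h4 : V G N g (0 + 1) / G ^ 2 = 4 := by
      simp [V]
      field_simp
    rw [h4]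
    simp only [zero_add, Finset.Ico_self, Finset.sum_empty, sub_self, mul_zero, objective,
      inner_zero_left, psi_eq hG hε (hN0 1 y)]
    exact potential_nonneg hG (lt_of_lt_of_le (by positivity) hv) (alpha_pos hG hε hv) (hN0 1 y)
  | succ k ih =>
    intro hk y
    have hmem : k + 1 ∈ Finset.Icc 1 T := by simp; omega
    have hle' := hle (k + 1) (by simp; omega)
    have hv := four_mul_sq_le_V (G := G) (N := N) (g := g) (k + 1)
    have hγ := dualNorm_nonneg (hN (k + 1)) hle' (g (k + 1))
    have hV := V_succ (G := G) (N := N) (g := g) (t := k + 1) (by omega)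
    have hmin := hw _ hmem
    have hv' := four_mul_sq_le_V (G := G) (N := N) (g := g) (k + 1 + 1)
    have hα' := alpha_pos hG hε hv'
    rw [show objective G ε N g (k + 1) = fun y => ⟪∑ s ∈ Finset.Ico 1 (k + 1), g s, y⟫_ℝ +
      potential G (V G N g (k + 1)) (alpha G ε (V G N g (k + 1))) (ipNorm (P (k + 1)) y) from
      funext fun y => by rw [objective, psi_eq hG hε (hN0 _ y), hN]] at hmin
    have hround := ftrl_round (P (k + 1)) hG hv hα'
      (alpha_anti hG hε hv (by rw [hV]; nlinarith)) hγ (hg _ hmem)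
      (fun h => by
        have := abs_inner_le_dualNorm_mul (hN (k + 1)) hle' (g (k + 1)) h
        rwa [← hN (k + 1)]) hmin y
    have hsum := sq_mul_alpha_div_sqrt_le hG hε hv hγ (hg _ hmem)
    rw [← hV] at hround hsum
    -- `ftrl_round` keeps the current norm; monotonicity of the potential passes to the next, larger
    -- one.
    have hpot := potential_mono hG (lt_of_lt_of_le (by positivity) hv') hα' (hN0 (k + 1) y)
      (hmono _ hmem y)
    have hih := ih (by omega) (w (k + 1))
    rw [objective, psi_eq hG hε (hN0 _ _)] at hih ⊢
    rw [Finset.sum_Ico_succ_top (show 1 ≤ k + 1 by omega) (fun t => ⟪g t, w t⟫_ℝ),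
      Finset.sum_Ico_succ_top (show 1 ≤ k + 1 by omega) g]
    rw [← hN (k + 1)] at hround
    linarith

end Regret

end FTRL

end

/-! ### The regret bound. -/

theorem mainTheorem8 :
    ∃ C : ℝ, 0 < C ∧
      ∀ (W : Type*) [NormedAddCommGroup W] [InnerProductSpace ℝ W] [CompleteSpace W]
        (T : ℕ) (P : ℕ → InnerProductSpace.Core ℝ W) (N : ℕ → W → ℝ)
        (_ : ∀ t, N t = FTRL.ipNorm (P t))
        (_ : ∀ t ∈ Finset.Icc 1 (T + 1), ∀ v : W, ‖v‖ ≤ N t v)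
        (_ : ∀ t ∈ Finset.Icc 1 T, ∀ v : W, N t v ≤ N (t + 1) v)
        (l : ℕ → W → ℝ) (g w : ℕ → W) (G ε : ℝ) (_ : 0 < G) (_ : 0 < ε)
        (_ : ∀ t ∈ Finset.Icc 1 T, ConvexOn ℝ Set.univ (l t))
        (_ : ∀ t ∈ Finset.Icc 1 T, FTRL.IsSubgradientAt (l t) (g t) (w t))
        (_ : ∀ t ∈ Finset.Icc 1 T, FTRL.dualNorm (N t) (g t) ≤ G)
        (_ : ∀ t ∈ Finset.Icc 1 T, IsMinOn (FTRL.objective G ε N g t) Set.univ (w t))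
        (u : W),
        FTRL.regret l w T u ≤
          C * (G * ε +
            (1 + Real.log (Real.log (FTRL.V G N g T / G ^ 2))) *
              (N (T + 1) u *
                max
                  (√(FTRL.V G N g T *
                    Real.log (N (T + 1) u * √(FTRL.V G N g T) / (ε * G) + 1)))
                  (G * Real.log (N (T + 1) u * √(FTRL.V G N g T) / (ε * G) + 1)))) := by
  -- `224 = 200 + 3 * 2 * 4`: the summed errors, plus the factors from `potential_le`, `slopeVal_le`
  -- and `mul_max_le`.
  refine ⟨224, by norm_num, ?_⟩
  intro W _ _ _ T P N hN hle hmono l g w G ε hG hε _ hsub hg hw u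
  have hU : 0 ≤ N (T + 1) u := by rw [hN]; exact FTRL.ipNorm_nonneg _ _
  have hG2 : 0 < G ^ 2 := by positivity
  have hv := FTRL.four_mul_sq_le_V (G := G) (N := N) (g := g) T
  have hv' := FTRL.four_mul_sq_le_V (G := G) (N := N) (g := g) (T + 1)
  have hv0 : 0 < FTRL.V G N g T := by linarith
  have hv0' : 0 < FTRL.V G N g (T + 1) := by linarith
  -- The regularizer at time `T + 1` involves `V (T + 1)`, the bound only `V T`. One more gradient
  -- adds at most `G ^ 2 ≤ V T / 4`; for `T = 0` both sums are empty.
  have hVV : FTRL.V G N g T ≤ FTRL.V G N g (T + 1) ∧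
      FTRL.V G N g (T + 1) ≤ 5 / 4 * FTRL.V G N g T := by
    rcases Nat.eq_zero_or_pos T with rfl | hT
    · have : FTRL.V G N g (0 + 1) = FTRL.V G N g 0 := by simp [FTRL.V]
      rw [this]
      constructor <;> linarith
    · have hγ := FTRL.dualNorm_nonneg (hN T) (hle T (by simp; omega)) (g T)
      have hγG := hg T (by simp; omega)
      rw [FTRL.V_succ hT]
      constructor <;> nlinarith
  have hobj := FTRL.sum_inner_le_objective T P hN hle hmono hG hε hg hw T le_rfl u
  have hreg : FTRL.regret l w T u ≤ ∑ t ∈ Finset.Ico 1 (T + 1), ⟪g t, w t⟫_ℝ -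
      ⟪∑ t ∈ Finset.Ico 1 (T + 1), g t, u⟫_ℝ := by
    rw [sum_inner, ← Finset.sum_sub_distrib, FTRL.regret, show Finset.Icc 1 T =
      Finset.Ico 1 (T + 1) from rfl]
    apply Finset.sum_le_sum
    intro t ht
    have := hsub t (by simp at ht ⊢; omega) u
    rw [inner_sub_right] at this
    linarith
  have herr : 1 / Real.log 4 - 1 / Real.log (FTRL.V G N g (T + 1) / G ^ 2) ≤ 1 := by
    have h1 := FTRL.one_le_log_of_four_le (le_refl (4 : ℝ))
    have h2 := FTRL.one_le_log_of_four_le ((le_div_iff₀ hG2).2 hv')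
    have h3 : 1 / Real.log 4 ≤ 1 := (div_le_one (by linarith)).2 h1
    have h4 : 0 ≤ 1 / Real.log (FTRL.V G N g (T + 1) / G ^ 2) := by positivity
    linarith
  have herr' := mul_le_mul_of_nonneg_left herr (show 0 ≤ 200 * (G * ε) by positivity)
  rw [FTRL.objective, FTRL.psi_eq hG hε hU] at hobj
  have hα' := FTRL.alpha_pos hG hε hv'
  have hpot := FTRL.potential_le hG hv0' hα' hU
  have hslope := mul_le_mul_of_nonneg_left
    (FTRL.slopeVal_le (G := G) (L := FTRL.logRatio (FTRL.alpha G ε (FTRL.V G N g (T + 1)))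
      (N (T + 1) u)) hv0') hU
  have hmax := FTRL.mul_max_le hG hε hv hVV.1 hVV.2 hU
  have hloglog : 0 ≤ Real.log (Real.log (FTRL.V G N g T / G ^ 2)) :=
    Real.log_nonneg (FTRL.one_le_log_of_four_le ((le_div_iff₀ hG2).2 hv))
  have hpos : 0 ≤ (1 + Real.log (Real.log (FTRL.V G N g T / G ^ 2))) *
      (N (T + 1) u * max
        (√(FTRL.V G N g T * Real.log (N (T + 1) u * √(FTRL.V G N g T) / (ε * G) + 1)))
        (G * Real.log (N (T + 1) u * √(FTRL.V G N g T) / (ε * G) + 1))) :=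
    mul_nonneg (by linarith) (mul_nonneg hU ((Real.sqrt_nonneg _).trans (le_max_left _ _)))
  have hGε : 0 < G * ε := by positivity
  linarith
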